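/- Let $X$ be a set with at least two elements (possibly infinite) and let $r\colon X\times X\to X\times X$, $r(x,y)=(\sigma_x(y),\tau_y(x))$, be an involutive non-degenerate solution of the Yang–Baxter equation, i.e. $r^2=\mathrm{id}$, all maps $\sigma_x,\tau_x\colon X\to X$ are bijective, and $(r\times\mathrm{id})(\mathrm{id}\times r)(r\times\mathrm{id})=(\mathrm{id}\times r)(r\times\mathrm{id})(\mathrm{id}\times r)$. A left brace is a set $A$ with an abelian group structure $(A,+)$ and a group structure $(A,\circ)$ such that $a\circ(b+c)=a\circ b-a+a\circ c$ for all $a,b,c\in A$; put $\lambda_a(b)=-a+a\circ b$. A left ideal of $A$ is a subgroup $I$ of $(A,+)$ with $\lambda_a(I)\subseteq I$ for all $a\in A$; it is trivial as a left brace if $a+b=a\circ b$ for all $a,b\in I$. The socle is the ideal $\mathrm{Soc}(A)=\{a\in A:\lambda_a=\mathrm{id}\}$. Let $G(X,r)$ be the group generated by $X$ with relations $x\circ y=u\circ v$ whenever $r(x,y)=(u,v)$, with its canonical left brace structure, in which $(G(X,r),\circ)$ is this group, the additive group is free abelian on $X$, and $\lambda_x(y)=\sigma_x(y)$ for $x,y\in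 X$; and let $\mathcal G(X,r)=G(X,r)/\mathrm{Soc}(G(X,r))$ be the quotient left brace. The retraction $\mathrm{Ret}(X,r)$ is the solution induced by $r$ on the set of classes of the equivalence relation $x\sim y\iff\sigma_x=\sigma_y$; put $\mathrm{Ret}^0(X,r)=(X,r)$ and $\mathrm{Ret}^{n}(X,r)=\mathrm{Ret}(\mathrm{Ret}^{n-1}(X,r))$ for $n\ge 1$. The solution $(X,r)$ is multipermutation of level $m$ if $\mathrm{Ret}^m(X,r)$ has exactly one element and $\mathrm{Ret}^{m-1}(X,r)$ has more than one element. If there are left ideals $B$ and $C$ of $\mathcal G(X,r)$, both trivial as left braces, such that $\mathcal G(X,r)=B+C$, then $(X,r)$ is a multipermutation solution of level $m$ for some $m\le 3$. -/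

import Mathlib

universe u

/-! ### Left braces -/

/-- A left brace: an abelian group `(A, +)` and a group `(A, ∘)` on the same set (the operation `∘` is
written `*`) such that `a ∘ (b + c) = a ∘ b - a + a ∘ c`. -/
class LeftBrace (A : Type u) extends AddCommGroup A, Group A where
  mul_add_brace : ∀ a b c : A, a * (b + c) = a * b - a + a * c

namespace LeftBrace

variable {A : Type u} [LeftBrace A]

/-- `λ_a(b) = -a + a ∘ b`. -/
def lam (a b : A) : A := -a + a * b

theorem mul_eq (a b : A) : a * b = a + lam a b := by simp [lam]

theorem lam_add (a b c : A) : lam a (b + c) = lam a b + lam a c := by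
  simp only [lam, mul_add_brace]; abel

theorem one_eq_zero : (1 : A) = 0 := by
  have h := mul_add_brace (1 : A) 0 0
  simpa using h

theorem lam_zero (a : A) : lam a 0 = 0 := by
  simpa using lam_add a 0 0

theorem lam_neg (a b : A) : lam a (-b) = -lam a b := by
  have h := lam_add a b (-b)
  rw [add_neg_cancel, lam_zero] at h
  exact (neg_eq_of_add_eq_zero_right h.symm).symm

theorem lam_mul (a b c : A) : lam (a * b) c = lam a (lam b c) := by
  have h : a * (b * c) = a + (lam a b + lam a (lam b c)) := by
    rw [mul_eq a, mul_eq b, lam_add]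
  have h2 : a * b = a + lam a b := mul_eq a b
  unfold lam at h h2 ⊢
  rw [mul_assoc, h]
  abel

theorem lam_one (b : A) : lam 1 b = b := by simp [lam, one_eq_zero]

/-- A left ideal: a subgroup of `(A, +)` that every `λ_a` maps into itself. -/
def IsLeftIdeal (I : AddSubgroup A) : Prop := ∀ a : A, ∀ b ∈ I, lam a b ∈ I

/-- An ideal: a left ideal that is normal in `(A, ∘)` (normality in `(A, +)` is automatic here). -/
structure IsIdeal (I : AddSubgroup A) : Prop where
  isLeftIdeal : IsLeftIdeal I
  conj_mem : ∀ a : A, ∀ b ∈ I, a * b * a⁻¹ ∈ I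

/-- A left ideal (hence a left subbrace) is trivial as a left brace if `+` and `∘` agree on it. -/
def IsTrivialOn (I : AddSubgroup A) : Prop := ∀ a ∈ I, ∀ b ∈ I, a + b = a * b

/-- `A` admits a factorization through the left ideals `B` and `C` if `A = B + C`. -/
structure IsFactorization (B C : AddSubgroup A) : Prop where
  left_isLeftIdeal : IsLeftIdeal B
  right_isLeftIdeal : IsLeftIdeal C
  exists_add : ∀ a : A, ∃ b ∈ B, ∃ c ∈ C, a = b + c

variable (A) in
/-- The socle of a left brace: the kernel of `λ` (the centre of `(A, +)` being all of `A`). -/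
def socle : AddSubgroup A where
  carrier := {a | ∀ b : A, lam a b = b}
  zero_mem' := fun b => by rw [← one_eq_zero, lam_one]
  add_mem' := by
    intro a b ha hb c
    have h : a + b = a * b := by rw [mul_eq, ha]
    rw [h, lam_mul, hb, ha]
  neg_mem' := by
    intro a ha c
    have h : -a = a⁻¹ := by
      have h1 := mul_eq a a⁻¹
      rw [ha, mul_inv_cancel, one_eq_zero] at h1
      exact neg_eq_of_add_eq_zero_right h1.symm
    have h2 := lam_mul a⁻¹ a c
    rw [inv_mul_cancel, lam_one, ha] at h2
    rw [h, ← h2]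

theorem mem_socle {a : A} : a ∈ socle A ↔ ∀ b : A, lam a b = b := Iff.rfl

theorem socle_isIdeal : IsIdeal (socle A) := by
  have key : ∀ a : A, ∀ b ∈ socle A, a * b * a⁻¹ ∈ socle A := by
    intro a b hb c
    rw [lam_mul, lam_mul, hb, ← lam_mul, mul_inv_cancel, lam_one]
  refine ⟨fun a b hb => ?_, key⟩
  have h : lam a b = a * b * a⁻¹ := by
    rw [mul_assoc, mul_eq a, mul_eq b, hb, lam_add, add_comm (lam a b), ← add_assoc, ← mul_eq,
      mul_inv_cancel, one_eq_zero, zero_add]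
  rw [h]
  exact key a b hb

section Quotient

variable {I : AddSubgroup A}

/-- Additive and multiplicative left cosets of an ideal agree. -/
theorem IsIdeal.sub_mem_iff (hI : IsIdeal I) (a b : A) : -a + b ∈ I ↔ a⁻¹ * b ∈ I := by
  have e : -a + b = lam a (a⁻¹ * b) := by simp [lam]
  constructor
  · intro h
    have := hI.isLeftIdeal a⁻¹ _ h
    rwa [e, ← lam_mul, inv_mul_cancel, lam_one] at this
  · intro h
    rw [e]
    exact hI.isLeftIdeal a _ h

theorem IsIdeal.mul_compat (hI : IsIdeal I) (a a' b b' : A) (ha : a⁻¹ * a' ∈ I) (hb : b⁻¹ * b' ∈ I) :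
    (a * b)⁻¹ * (a' * b') ∈ I := by
  have h1 : (a * b)⁻¹ * (a' * b') = (b⁻¹ * (a⁻¹ * a') * b⁻¹⁻¹) * (b⁻¹ * b') := by group
  rw [h1, mul_eq]
  exact I.add_mem (hI.conj_mem _ _ ha) (hI.isLeftIdeal _ _ hb)

theorem IsIdeal.inv_compat (hI : IsIdeal I) (a a' : A) (ha : a⁻¹ * a' ∈ I) : a⁻¹⁻¹ * a'⁻¹ ∈ I := by
  have h0 : ∀ c ∈ I, c⁻¹ ∈ I := by
    intro c hc
    have h1 : c⁻¹ = -lam c⁻¹ c := by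
      have := mul_eq c⁻¹ c
      rw [inv_mul_cancel, one_eq_zero] at this
      exact eq_neg_of_add_eq_zero_left this.symm
    rw [h1]
    exact I.neg_mem (hI.isLeftIdeal _ _ hc)
  have h1 : a⁻¹⁻¹ * a'⁻¹ = a * (a⁻¹ * a')⁻¹ * a⁻¹ := by group
  rw [h1]
  exact hI.conj_mem _ _ (h0 _ ha)

/-- The carrier of the quotient brace `A / I`: the cosets of the ideal `I`. -/
def QuotientBrace (I : AddSubgroup A) (_hI : IsIdeal I) : Type u := A ⧸ I

variable (hI : IsIdeal I)

instance : AddCommGroup (QuotientBrace I hI) := inferInstanceAs (AddCommGroup (A ⧸ I))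

/-- The canonical projection `A → A / I`. -/
def QuotientBrace.mk (a : A) : QuotientBrace I hI := (QuotientAddGroup.mk a : A ⧸ I)

theorem QuotientBrace.mk_eq {a b : A} : QuotientBrace.mk hI a = QuotientBrace.mk hI b ↔ a⁻¹ * b ∈ I := by
  rw [← hI.sub_mem_iff]
  exact QuotientAddGroup.eq

theorem QuotientBrace.mk_surjective : Function.Surjective (QuotientBrace.mk hI) := QuotientAddGroup.mk_surjective

/-- The multiplicative group of `A / I`. -/
instance : Group (QuotientBrace I hI) where
  mul := Quotient.map₂ (· * ·) (by
    intro a a' ha b b' hb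
    refine QuotientAddGroup.leftRel_apply.2 ((hI.sub_mem_iff _ _).2 (hI.mul_compat _ _ _ _ ?_ ?_))
    · exact (hI.sub_mem_iff _ _).1 (QuotientAddGroup.leftRel_apply.1 ha)
    · exact (hI.sub_mem_iff _ _).1 (QuotientAddGroup.leftRel_apply.1 hb))
  one := QuotientBrace.mk hI 1
  inv := Quotient.map (·⁻¹) (by
    intro a a' ha
    exact QuotientAddGroup.leftRel_apply.2 ((hI.sub_mem_iff _ _).2 (hI.inv_compat _ _
      ((hI.sub_mem_iff _ _).1 (QuotientAddGroup.leftRel_apply.1 ha)))))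
  mul_assoc := by
    rintro ⟨a⟩ ⟨b⟩ ⟨c⟩
    exact congrArg (QuotientBrace.mk hI) (mul_assoc a b c)
  one_mul := by
    rintro ⟨a⟩
    exact congrArg (QuotientBrace.mk hI) (one_mul a)
  mul_one := by
    rintro ⟨a⟩
    exact congrArg (QuotientBrace.mk hI) (mul_one a)
  inv_mul_cancel := by
    rintro ⟨a⟩
    exact congrArg (QuotientBrace.mk hI) (inv_mul_cancel a)

theorem QuotientBrace.mk_mul (a b : A) : QuotientBrace.mk hI (a * b) = QuotientBrace.mk hI a * QuotientBrace.mk hI b := rfl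

theorem QuotientBrace.mk_add (a b : A) : QuotientBrace.mk hI (a + b) = QuotientBrace.mk hI a + QuotientBrace.mk hI b := rfl

/-- The quotient brace `A / I`, with both operations induced from `A`. -/
instance : LeftBrace (QuotientBrace I hI) where
  mul_add_brace := by
    rintro ⟨a⟩ ⟨b⟩ ⟨c⟩
    exact congrArg (QuotientBrace.mk hI) (mul_add_brace a b c)

end Quotient

end LeftBrace

/-! ### Involutive non-degenerate solutions of the Yang-Baxter equation -/

namespace YB

/-- `r × id` on `X × X × X`. -/
def r12 {X : Type u} (r : X × X → X × X) (p : X × X × X) : X × X × X :=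
  ((r (p.1, p.2.1)).1, (r (p.1, p.2.1)).2, p.2.2)

/-- `id × r` on `X × X × X`. -/
def r23 {X : Type u} (r : X × X → X × X) (p : X × X × X) : X × X × X := (p.1, r p.2)

/-- An involutive non-degenerate set-theoretic solution of the Yang-Baxter equation on `X`, where
`r (x, y) = (σ_x y, τ_y x)`. Bijectivity of `r` follows from `r ∘ r = id`. -/
structure Solution (X : Type u) where
  r : X × X → X × X
  yang_baxter : r12 r ∘ r23 r ∘ r12 r = r23 r ∘ r12 r ∘ r23 r
  bijective_left : ∀ x, Function.Bijective fun y => (r (x, y)).1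
  bijective_right : ∀ y, Function.Bijective fun x => (r (x, y)).2
  involutive : Function.Involutive r

namespace Solution

variable {X : Type u} (S : Solution X)

/-- `σ_x`. -/
noncomputable def sig (x : X) : Equiv.Perm X := Equiv.ofBijective _ (S.bijective_left x)

/-- `τ_y`. -/
noncomputable def tau (y : X) : Equiv.Perm X := Equiv.ofBijective _ (S.bijective_right y)

theorem r_eq (x y : X) : S.r (x, y) = (S.sig x y, S.tau y x) := rfl

theorem sig_sig_tau (x y : X) : S.sig (S.sig x y) (S.tau y x) = x :=
  congrArg Prod.fst (S.involutive (x, y))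

theorem tau_tau_sig (x y : X) : S.tau (S.tau y x) (S.sig x y) = y :=
  congrArg Prod.snd (S.involutive (x, y))

theorem sig_mul (x y : X) : S.sig x * S.sig y = S.sig (S.sig x y) * S.sig (S.tau y x) := by
  ext z
  exact (congrArg Prod.fst (congrFun S.yang_baxter (x, y, z))).symm

/-- The solution with the two coordinates exchanged. -/
def op : Solution X where
  r := fun p => (S.r p.swap).swap
  yang_baxter := by
    funext p
    obtain ⟨x, y, z⟩ := p
    have h := congrFun S.yang_baxter (z, y, x)
    have h1 := congrArg Prod.fst h
    have h2 := congrArg (fun q => q.2.1) h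
    have h3 := congrArg (fun q => q.2.2) h
    exact Prod.ext h3.symm (Prod.ext h2.symm h1.symm)
  bijective_left := S.bijective_right
  bijective_right := S.bijective_left
  involutive := fun p => by simp [S.involutive _]

/-- The diagonal map `T(x) = σ_x⁻¹(x)`. -/
noncomputable def diag (x : X) : X := (S.sig x)⁻¹ x

theorem sig_diag (x : X) : S.sig x (S.diag x) = x := by simp [diag]

theorem tau_diag (x : X) : S.tau (S.diag x) x = S.diag x := by
  have h := S.sig_sig_tau x (S.diag x)
  rw [sig_diag] at h
  exact (S.sig x).injective (h.trans (S.sig_diag x).symm)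

theorem op_diag_diag (x : X) : S.op.diag (S.diag x) = x := by
  apply (S.tau (S.diag x)).injective
  rw [tau_diag]
  exact S.op.sig_diag (S.diag x)

theorem diag_op_diag (x : X) : S.diag (S.op.diag x) = x := S.op.op_diag_diag x

theorem diag_tau (x y : X) : S.diag (S.tau y x) = (S.sig y)⁻¹ (S.diag x) := by
  have h := S.sig_mul x y
  have h2 : S.tau y x = (S.sig (S.sig x y))⁻¹ x := by
    rw [Equiv.Perm.eq_inv_iff_eq]; exact S.sig_sig_tau x y
  have h3 : (S.sig (S.tau y x))⁻¹ = (S.sig y)⁻¹ * (S.sig x)⁻¹ * S.sig (S.sig x y) := by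
    rw [← mul_inv_rev, h]; group
  unfold diag
  rw [h3]
  simp only [Equiv.Perm.mul_apply, sig_sig_tau]

theorem tau_eq_of_sig_eq {y y' : X} (h : S.sig y = S.sig y') : S.tau y = S.tau y' := by
  ext x
  have : S.diag (S.tau y x) = S.diag (S.tau y' x) := by rw [diag_tau, diag_tau, h]
  rw [← S.op_diag_diag (S.tau y x), this, op_diag_diag]

theorem sig_eq_iff_tau_eq {y y' : X} : S.sig y = S.sig y' ↔ S.tau y = S.tau y' :=
  ⟨S.tau_eq_of_sig_eq, S.op.tau_eq_of_sig_eq⟩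

/-! ### The retraction -/

/-- `x ∼ y` if and only if `σ_x = σ_y`. -/
noncomputable def retSetoid : Setoid X := Setoid.comap S.sig ⊥

theorem sig_tau_congr (y : X) {x x' : X} (h : S.sig x = S.sig x') :
    S.sig (S.tau y x) = S.sig (S.tau y x') := by
  have h1 := S.sig_mul x y
  have h2 := S.sig_mul x' y
  rw [← h, h1] at h2
  exact mul_left_cancel h2

theorem sig_sig_congr (y : X) {x x' : X} (h : S.sig x = S.sig x') :
    S.sig (S.sig y x) = S.sig (S.sig y x') :=
  S.sig_eq_iff_tau_eq.2 (S.op.sig_tau_congr y (S.sig_eq_iff_tau_eq.1 h))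

theorem sig_sig_cancel (y : X) {x x' : X} (h : S.sig (S.sig y x) = S.sig (S.sig y x')) :
    S.sig x = S.sig x' := by
  have key : ∀ x, S.sig y * S.sig x = S.sig (S.sig y x) * S.sig ((S.sig (S.sig y x))⁻¹ y) := by
    intro x
    rw [S.sig_mul y x]
    congr 2
    rw [Equiv.Perm.eq_inv_iff_eq]
    exact S.sig_sig_tau y x
  have h1 := key x
  rw [h, ← key x'] at h1
  exact mul_left_cancel h1

theorem sig_tau_cancel (y : X) {x x' : X} (h : S.sig (S.tau y x) = S.sig (S.tau y x')) :
    S.sig x = S.sig x' :=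
  S.sig_eq_iff_tau_eq.2 (S.op.sig_sig_cancel y (S.sig_eq_iff_tau_eq.1 h))

/-- The underlying set of the retraction. -/
def RetType : Type u := Quotient S.retSetoid

/-- The class of an element in the retraction. -/
noncomputable def toRet (x : X) : S.RetType := Quotient.mk S.retSetoid x

theorem toRet_eq {x y : X} : S.toRet x = S.toRet y ↔ S.sig x = S.sig y := Quotient.eq

theorem toRet_surjective : Function.Surjective S.toRet := Quotient.mk_surjective

/-- The map induced by `r` on equivalence classes. -/
noncomputable def retMap (p : S.RetType × S.RetType) : S.RetType × S.RetType :=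
  Quotient.liftOn₂ p.1 p.2 (fun x y => (S.toRet (S.r (x, y)).1, S.toRet (S.r (x, y)).2)) (by
    intro x y x' y' (hx : S.sig x = S.sig x') (hy : S.sig y = S.sig y')
    refine Prod.ext (S.toRet_eq.2 ?_) (S.toRet_eq.2 ?_)
    · change S.sig (S.sig x y) = S.sig (S.sig x' y')
      rw [hx]
      exact S.sig_sig_congr x' hy
    · change S.sig (S.tau y x) = S.sig (S.tau y' x')
      rw [S.tau_eq_of_sig_eq hy]
      exact S.sig_tau_congr y' hx)

theorem retMap_mk (x y : X) :
    S.retMap (S.toRet x, S.toRet y) = (S.toRet (S.r (x, y)).1, S.toRet (S.r (x, y)).2) := rfl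

/-- The retraction `Ret(X, r)`. -/
noncomputable def ret : Solution S.RetType where
  r := S.retMap
  yang_baxter := by
    funext ⟨a, b, c⟩
    obtain ⟨x, rfl⟩ := S.toRet_surjective a
    obtain ⟨y, rfl⟩ := S.toRet_surjective b
    obtain ⟨z, rfl⟩ := S.toRet_surjective c
    exact congrArg (fun q : X × X × X => (S.toRet q.1, S.toRet q.2.1, S.toRet q.2.2))
      (congrFun S.yang_baxter (x, y, z))
  bijective_left := by
    intro a
    obtain ⟨x, rfl⟩ := S.toRet_surjective a
    constructor
    · intro b c h
      obtain ⟨y, rfl⟩ := S.toRet_surjective b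
      obtain ⟨z, rfl⟩ := S.toRet_surjective c
      exact S.toRet_eq.2 (S.sig_sig_cancel x (S.toRet_eq.1 h))
    · intro b
      obtain ⟨y, rfl⟩ := S.toRet_surjective b
      obtain ⟨z, rfl⟩ := (S.sig x).surjective y
      exact ⟨S.toRet z, rfl⟩
  bijective_right := by
    intro a
    obtain ⟨x, rfl⟩ := S.toRet_surjective a
    constructor
    · intro b c h
      obtain ⟨y, rfl⟩ := S.toRet_surjective b
      obtain ⟨z, rfl⟩ := S.toRet_surjective c
      exact S.toRet_eq.2 (S.sig_tau_cancel x (S.toRet_eq.1 h))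
    · intro b
      obtain ⟨y, rfl⟩ := S.toRet_surjective b
      obtain ⟨z, rfl⟩ := (S.tau x).surjective y
      exact ⟨S.toRet z, rfl⟩
  involutive := by
    rintro ⟨a, b⟩
    obtain ⟨x, rfl⟩ := S.toRet_surjective a
    obtain ⟨y, rfl⟩ := S.toRet_surjective b
    exact congrArg (fun q : X × X => (S.toRet q.1, S.toRet q.2)) (S.involutive (x, y))

/-- The iterated retraction `Ret^n(X, r)`, a set together with a solution on it. -/
noncomputable def iterRet : ℕ → Σ Y : Type u, Solution Y
  | 0 => ⟨X, S⟩
  | n + 1 => ⟨(iterRet n).2.RetType, (iterRet n).2.ret⟩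

/-- `(X, r)` is multipermutation of level `m`: `Ret^m(X, r)` has exactly one element, and
`Ret^(m-1)(X, r)` has more than one (the latter is void for `m = 0`). -/
def IsMultipermutation (m : ℕ) : Prop :=
  Nat.card (S.iterRet m).1 = 1 ∧ ∀ k, m = k + 1 → Nontrivial (S.iterRet k).1

/-! ### The structure group and its left brace structure -/

/-- The defining relators of the structure group: `x ∘ y = u ∘ v` whenever `r (x, y) = (u, v)`. -/
def rels : Set (FreeGroup X) :=
  {w | ∃ x y u v : X, S.r (x, y) = (u, v) ∧
    w = FreeGroup.of x * FreeGroup.of y * (FreeGroup.of u * FreeGroup.of v)⁻¹}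

/-- The structure group `G(X, r)`. -/
def StructureGroup : Type u := PresentedGroup S.rels

noncomputable instance : Group S.StructureGroup := inferInstanceAs (Group (PresentedGroup S.rels))

/-- The canonical map `X → G(X, r)`. -/
def of (x : X) : S.StructureGroup := PresentedGroup.of (rels := S.rels) x

theorem of_mul_of (x y : X) : S.of x * S.of y = S.of (S.sig x y) * S.of (S.tau y x) := by
  have h : (PresentedGroup.mk S.rels)
      (FreeGroup.of x * FreeGroup.of y *
        (FreeGroup.of (S.sig x y) * FreeGroup.of (S.tau y x))⁻¹) = 1 :=
    PresentedGroup.one_of_mem ⟨x, y, _, _, S.r_eq x y, rfl⟩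
  rw [map_mul, map_inv, mul_inv_eq_one, map_mul, map_mul] at h
  exact h

/-- Homomorphisms out of `G(X, r)`. -/
noncomputable def lift {H : Type u} [Group H] (f : X → H)
    (hf : ∀ x y, f x * f y = f (S.sig x y) * f (S.tau y x)) : S.StructureGroup →* H :=
  PresentedGroup.toGroup (rels := S.rels) (f := f) (by
    rintro w ⟨x, y, u, v, h, rfl⟩
    rw [r_eq, Prod.mk.injEq] at h
    obtain ⟨rfl, rfl⟩ := h
    simp [hf x y])

theorem lift_of {H : Type u} [Group H] (f : X → H)
    (hf : ∀ x y, f x * f y = f (S.sig x y) * f (S.tau y x)) (x : X) :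
    S.lift f hf (S.of x) = f x := PresentedGroup.toGroup.of _

theorem structureGroup_induction {p : S.StructureGroup → Prop} (one : p 1)
    (mul_of : ∀ g x, p g → p (g * S.of x)) (mul_inv : ∀ g x, p g → p (g * (S.of x)⁻¹))
    (g : S.StructureGroup) : p g := by
  have hg : g ∈ Subgroup.closure (Set.range S.of) := by
    have h : Subgroup.closure (Set.range S.of) = ⊤ := PresentedGroup.closure_range_of S.rels
    rw [h]; trivial
  induction hg using Subgroup.closure_induction_right with
  | one => exact one
  | mul_right g _ y hy ih => obtain ⟨x, rfl⟩ := hy; exact mul_of g x ih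
  | mul_inv_cancel g _ y hy ih => obtain ⟨x, rfl⟩ := hy; exact mul_inv g x ih

/-- The action of `G(X, r)` on `X` in which `x` acts as `σ_x`. -/
noncomputable def perm : S.StructureGroup →* Equiv.Perm X := S.lift S.sig S.sig_mul

theorem perm_of (x : X) : S.perm (S.of x) = S.sig x := S.lift_of _ _ x

/-- A permutation of `X` extended to the free abelian group `ℤ^(X)`. -/
def permMap (s : Equiv.Perm X) : FreeAbelianGroup X →+ FreeAbelianGroup X := FreeAbelianGroup.map s

theorem permMap_of (s : Equiv.Perm X) (x : X) :
    permMap s (FreeAbelianGroup.of x) = FreeAbelianGroup.of (s x) := FreeAbelianGroup.map_of_apply x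

theorem permMap_mul (s t : Equiv.Perm X) (m : FreeAbelianGroup X) :
    permMap (s * t) m = permMap s (permMap t m) :=
  FreeAbelianGroup.map_comp_apply (f := t) (g := s) m

theorem permMap_one (m : FreeAbelianGroup X) : permMap (1 : Equiv.Perm X) m = m :=
  FreeAbelianGroup.map_id_apply m

/-- The affine permutation `m ↦ e_x + σ_x(m)` of `ℤ^(X)`. -/
noncomputable def affOf (x : X) : Equiv.Perm (FreeAbelianGroup X) where
  toFun m := FreeAbelianGroup.of x + permMap (S.sig x) m
  invFun m := permMap (S.sig x)⁻¹ (-FreeAbelianGroup.of x + m)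
  left_inv m := by simp [← permMap_mul, permMap_one]
  right_inv m := by simp [← permMap_mul, permMap_one]

theorem affOf_apply (x : X) (m : FreeAbelianGroup X) :
    S.affOf x m = FreeAbelianGroup.of x + permMap (S.sig x) m := rfl

/-- The action of `G(X, r)` on `ℤ^(X)` by affine maps in which `x` acts as `m ↦ e_x + σ_x(m)`. -/
noncomputable def aff : S.StructureGroup →* Equiv.Perm (FreeAbelianGroup X) :=
  S.lift S.affOf (by
    intro x y
    ext m
    simp only [Equiv.Perm.mul_apply, affOf_apply, map_add, permMap_of, ← permMap_mul,
      ← S.sig_mul x y, sig_sig_tau]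
    abel)

/-- The cocycle `π : G(X, r) → ℤ^(X)`, `π(g) = g · 0`; thus `π(x) = e_x` and
`π(g ∘ h) = π(g) + g · π(h)` with `G(X, r)` permuting the basis `X` through `x ↦ σ_x`. -/
noncomputable def cocycle (g : S.StructureGroup) : FreeAbelianGroup X := S.aff g 0

theorem cocycle_of (x : X) : S.cocycle (S.of x) = FreeAbelianGroup.of x := by
  simp [cocycle, aff, lift_of, affOf_apply]

theorem aff_apply (g : S.StructureGroup) (m : FreeAbelianGroup X) :
    S.aff g m = S.cocycle g + permMap (S.perm g) m := by
  have hof : ∀ x m, S.aff (S.of x) m = FreeAbelianGroup.of x + permMap (S.sig x) m := by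
    intro x m
    rw [aff, lift_of, affOf_apply]
  unfold cocycle
  induction g using structureGroup_induction generalizing m with
  | one => simp [permMap_one]
  | mul_of g x ih =>
    rw [map_mul, map_mul, Equiv.Perm.mul_apply, Equiv.Perm.mul_apply, ih, ih (S.aff (S.of x) 0),
      hof, hof, perm_of, permMap_mul]
    simp only [map_add, map_zero]
    abel
  | mul_inv g x ih =>
    have hinv : ∀ m, S.aff (S.of x)⁻¹ m = S.aff (S.of x)⁻¹ 0 + permMap (S.sig x)⁻¹ m := by
      intro m
      rw [map_inv, Equiv.Perm.inv_eq_iff_eq, hof, map_add, ← permMap_mul, mul_inv_cancel,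
        permMap_one, ← add_assoc, ← hof, ← Equiv.Perm.mul_apply, mul_inv_cancel]
      simp
    rw [map_mul, map_mul, Equiv.Perm.mul_apply, Equiv.Perm.mul_apply, ih,
      ih (S.aff (S.of x)⁻¹ 0), hinv, map_inv S.perm, perm_of, permMap_mul]
    simp only [map_add]
    abel

theorem cocycle_mul (g h : S.StructureGroup) :
    S.cocycle (g * h) = S.cocycle g + permMap (S.perm g) (S.cocycle h) := by
  rw [← aff_apply]
  simp [cocycle]

/-- The permutation `g ↦ g ∘ (g⁻¹ · y)` of `G(X, r)`; it corresponds to adding `e_y` in `ℤ^(X)`. -/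
noncomputable def shift (y : X) : Equiv.Perm S.StructureGroup where
  toFun g := g * S.of ((S.perm g)⁻¹ y)
  invFun g := g * (S.of (S.op.diag ((S.perm g)⁻¹ y)))⁻¹
  left_inv g := by
    have h : S.op.diag ((S.perm (g * S.of ((S.perm g)⁻¹ y)))⁻¹ y) = (S.perm g)⁻¹ y := by
      rw [map_mul, perm_of, mul_inv_rev, Equiv.Perm.mul_apply]
      exact S.op_diag_diag _
    simp only [h, mul_inv_cancel_right]
  right_inv g := by
    have h : (S.perm (g * (S.of (S.op.diag ((S.perm g)⁻¹ y)))⁻¹))⁻¹ y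
        = S.op.diag ((S.perm g)⁻¹ y) := by
      rw [map_mul, map_inv, perm_of, mul_inv_rev, inv_inv, Equiv.Perm.mul_apply]
      conv_lhs => arg 2; rw [← S.diag_op_diag ((S.perm g)⁻¹ y)]
      exact S.sig_diag _
    simp only [h, inv_mul_cancel_right]

theorem shift_apply (y : X) (g : S.StructureGroup) :
    S.shift y g = g * S.of ((S.perm g)⁻¹ y) := rfl

theorem shift_comm (y z : X) : S.shift y * S.shift z = S.shift z * S.shift y := by
  ext g
  have h : ∀ x w : X, S.of x * S.of ((S.sig x)⁻¹ w) = S.of w * S.of ((S.sig w)⁻¹ x) := by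
    intro x w
    rw [of_mul_of]
    have e : S.sig x ((S.sig x)⁻¹ w) = w := by simp
    have e2 : S.tau ((S.sig x)⁻¹ w) x = (S.sig w)⁻¹ x := by
      rw [Equiv.Perm.eq_inv_iff_eq]
      have := S.sig_sig_tau x ((S.sig x)⁻¹ w)
      rwa [e] at this
    rw [e, e2]
  simp only [Equiv.Perm.mul_apply, shift_apply, map_mul, perm_of, mul_inv_rev, mul_assoc]
  rw [h]

theorem cocycle_shift (y : X) (g : S.StructureGroup) :
    S.cocycle (S.shift y g) = S.cocycle g + FreeAbelianGroup.of y := by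
  rw [shift_apply, cocycle_mul, cocycle_of, permMap_of]
  simp

/-- The cocycle is a bijection. -/
theorem cocycle_bijective : Function.Bijective S.cocycle := by
  have hcomm : IsMulCommutative (Subgroup.closure (Set.range S.shift)) :=
    Subgroup.isMulCommutative_closure (by
      rintro _ ⟨y, rfl⟩ _ ⟨z, rfl⟩
      exact S.shift_comm y z)
  let : CommGroup (Subgroup.closure (Set.range S.shift)) :=
    { (inferInstance : Group (Subgroup.closure (Set.range S.shift))) with
      mul_comm := hcomm.is_comm.comm }
  let F : FreeAbelianGroup X →+ Additive (Subgroup.closure (Set.range S.shift)) :=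
    FreeAbelianGroup.lift fun y =>
      Additive.ofMul ⟨S.shift y, Subgroup.subset_closure ⟨y, rfl⟩⟩
  let s : FreeAbelianGroup X → S.StructureGroup := fun m =>
    ((F m).toMul : Equiv.Perm S.StructureGroup) 1
  have s_add : ∀ y m, s (m + FreeAbelianGroup.of y) = S.shift y (s m) := by
    intro y m
    simp only [s]
    rw [add_comm, map_add]
    simp only [F, FreeAbelianGroup.lift_apply_of]
    rfl
  have s_sub : ∀ y m, s (m - FreeAbelianGroup.of y) = (S.shift y)⁻¹ (s m) := by
    intro y m
    rw [Equiv.Perm.eq_inv_iff_eq, ← s_add, sub_add_cancel]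
  have s_zero : s 0 = 1 := by simp [s]
  have c_one : S.cocycle 1 = 0 := by simp [cocycle]
  have hs : ∀ g, s (S.cocycle g) = g := by
    intro g
    induction g using structureGroup_induction with
    | one => rw [c_one, s_zero]
    | mul_of g x ih =>
      rw [cocycle_mul, cocycle_of, permMap_of, s_add, ih, shift_apply]
      simp
    | mul_inv g x ih =>
      have e : S.shift (S.perm (g * (S.of x)⁻¹) x) (g * (S.of x)⁻¹) = g := by
        rw [shift_apply]
        simp
      have e2 := S.cocycle_shift (S.perm (g * (S.of x)⁻¹) x) (g * (S.of x)⁻¹)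
      rw [e] at e2
      rw [← sub_eq_iff_eq_add] at e2
      rw [← e2, s_sub, ih, Equiv.Perm.inv_eq_iff_eq, e]
  refine ⟨Function.LeftInverse.injective hs, fun m => ⟨s m, ?_⟩⟩
  have key : ∀ a : FreeAbelianGroup X, ∀ m, S.cocycle (s (m + a)) = S.cocycle (s m) + a := by
    intro a
    induction a using FreeAbelianGroup.induction_on with
    | zero => simp
    | of x => intro m; rw [s_add, cocycle_shift]
    | neg x _ =>
      intro m
      have h := S.cocycle_shift x ((S.shift x)⁻¹ (s m))
      rw [← Equiv.Perm.mul_apply, mul_inv_cancel, Equiv.Perm.one_apply] at h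
      rw [← sub_eq_add_neg, s_sub, h, add_neg_cancel_right]
    | add a b ha hb => intro m; rw [← add_assoc, hb, ha, add_assoc]
  have := key m 0
  rwa [zero_add, s_zero, c_one, zero_add] at this

/-- The cocycle as an equivalence `G(X, r) ≃ ℤ^(X)`. -/
noncomputable def cocycleEquiv : S.StructureGroup ≃ FreeAbelianGroup X :=
  Equiv.ofBijective S.cocycle S.cocycle_bijective

/-- The additive group of `G(X, r)`: the structure of `ℤ^(X)` transported along the cocycle. -/
noncomputable instance : AddCommGroup S.StructureGroup := S.cocycleEquiv.addCommGroup

theorem cocycle_add (g h : S.StructureGroup) : S.cocycle (g + h) = S.cocycle g + S.cocycle h :=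
  S.cocycleEquiv.apply_symm_apply _

/-- The left brace `G(X, r)`. -/
noncomputable instance : LeftBrace S.StructureGroup where
  mul_add_brace := by
    intro a b c
    apply S.cocycle_bijective.injective
    have hsub : ∀ g h, S.cocycle (g - h) = S.cocycle g - S.cocycle h := by
      intro g h
      rw [eq_sub_iff_add_eq, ← cocycle_add, sub_add_cancel]
    rw [cocycle_add, hsub, cocycle_mul, cocycle_mul, cocycle_mul, cocycle_add, map_add]
    abel

/-- On generators the `λ`-action of the left brace `G(X, r)` is given by `σ`, that is,
`x ∘ y = x + σ_x(y)`. -/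
theorem of_mul_of_eq_add (x y : X) : S.of x * S.of y = S.of x + S.of (S.sig x y) := by
  apply S.cocycle_bijective.injective
  rw [cocycle_add, cocycle_mul, cocycle_of, cocycle_of, cocycle_of, perm_of, permMap_of]

/-- The permutation brace `𝒢(X, r) = G(X, r) / Soc(G(X, r))`. -/
abbrev PermutationBrace : Type u :=
  LeftBrace.QuotientBrace (LeftBrace.socle S.StructureGroup) LeftBrace.socle_isIdeal

end Solution

end YB

/-!
Write `λ_a(d) = -a + a ∘ d`. If a left brace `A = B + C` factorizes through two trivial left
ideals, then comparing the two sides of `c ∘ b = λ_c(b) ∘ c'` with `b ∈ B`, `c, c' ∈ C` shows that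
`b` and `λ_c(b)` act on `A` in the same way, so `A / Soc(A)` is a trivial brace.

On the other hand, retraction corresponds to division by the socle: if `X` embeds into a left brace
`A` as an additively generating set on which `λ` acts through `σ`, then `Ret(X, r)` embeds in the
same way into `A / Soc(A)`. Hence `X ⊆ G(X, r)` gives `Ret(X, r) ⊆ 𝒢(X, r)` and then
`Ret²(X, r) ⊆ 𝒢(X, r) / Soc(𝒢(X, r))`. When the last brace is trivial, every `σ` of `Ret²(X, r)` is
the identity, and one more retraction leaves a single point.
-/

namespace LeftBrace

variable {A : Type u} [LeftBrace A]

theorem lam_inv_lam (a b : A) : lam a⁻¹ (lam a b) = b := by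
  rw [← lam_mul, inv_mul_cancel, lam_one]

theorem lam_lam_inv (a b : A) : lam a (lam a⁻¹ b) = b := by
  rw [← lam_mul, mul_inv_cancel, lam_one]

theorem lam_inv_eq_iff {a b c : A} : lam a⁻¹ b = c ↔ b = lam a c :=
  ⟨fun h => by rw [← h, lam_lam_inv], fun h => by rw [h, lam_inv_lam]⟩

theorem add_eq_mul_lam_inv (a b : A) : a + b = a * lam a⁻¹ b := by
  rw [mul_eq, lam_lam_inv]

theorem mul_eq_lam_mul (a b : A) : a * b = lam a b * lam (lam a b)⁻¹ a := by
  rw [mul_eq a b, add_comm, add_eq_mul_lam_inv]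

theorem lam_eq_of_closure_eq_top {s : Set A} (hs : AddSubgroup.closure s = ⊤) {a b : A}
    (h : ∀ c ∈ s, lam a c = lam b c) (d : A) : lam a d = lam b d :=
  have lam_hom_eq : AddMonoidHom.mk' (lam a) (lam_add a) = AddMonoidHom.mk' (lam b) (lam_add b) :=
    AddMonoidHom.eq_of_eqOn_dense hs h
  DFunLike.congr_fun lam_hom_eq d

section Quotient

variable {I : AddSubgroup A} (hI : IsIdeal I)

theorem QuotientBrace.mk_lam (a b : A) :
    QuotientBrace.mk hI (lam a b) = lam (QuotientBrace.mk hI a) (QuotientBrace.mk hI b) := rfl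

theorem QuotientBrace.mk_socle_eq {a b : A} :
    QuotientBrace.mk socle_isIdeal a = QuotientBrace.mk socle_isIdeal b ↔
      ∀ d, lam a d = lam b d := by
  rw [QuotientBrace.mk_eq, mem_socle]
  refine forall_congr' fun d => ?_
  rw [lam_mul, lam_inv_eq_iff, eq_comm]

theorem QuotientBrace.closure_image_mk_eq_top {s : Set A} (hs : AddSubgroup.closure s = ⊤) :
    AddSubgroup.closure (QuotientBrace.mk hI '' s) = ⊤ := by
  let π : A →+ QuotientBrace I hI := AddMonoidHom.mk' (mk hI) (mk_add hI)
  calc AddSubgroup.closure (π '' s) = (AddSubgroup.closure s).map π := (π.map_closure s).symm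
    _ = ⊤ := by rw [hs, AddSubgroup.map_top_of_surjective π (mk_surjective hI)]

theorem QuotientBrace.isTrivialOn_top (h : ∀ a b : A, mk hI (lam a b) = mk hI b) :
    IsTrivialOn (⊤ : AddSubgroup (QuotientBrace I hI)) := by
  intro x _ y _
  obtain ⟨a, rfl⟩ := mk_surjective hI x
  obtain ⟨b, rfl⟩ := mk_surjective hI y
  rw [← mk_mul, mul_eq, mk_add, h]

end Quotient

theorem IsTrivialOn.lam_eq {I : AddSubgroup A} (hI : IsTrivialOn I) {a b : A} (ha : a ∈ I)
    (hb : b ∈ I) : lam a b = b := by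
  rw [lam, ← hI a ha b hb, neg_add_cancel_left]

namespace IsFactorization

variable {B C : AddSubgroup A}

theorem symm (h : IsFactorization B C) : IsFactorization C B where
  left_isLeftIdeal := h.right_isLeftIdeal
  right_isLeftIdeal := h.left_isLeftIdeal
  exists_add a :=
    let ⟨b, hb, c, hc, e⟩ := h.exists_add a
    ⟨c, hc, b, hb, e.trans (add_comm b c)⟩

theorem exists_mul (h : IsFactorization B C) (a : A) : ∃ b ∈ B, ∃ c ∈ C, a = b * c := by
  obtain ⟨b, hb, c, hc, rfl⟩ := h.exists_add a
  exact ⟨b, hb, lam b⁻¹ c, h.right_isLeftIdeal _ c hc, add_eq_mul_lam_inv b c⟩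

theorem lam_lam_eq (h : IsFactorization B C) (hB : IsTrivialOn B) (hC : IsTrivialOn C) {b c : A}
    (hb : b ∈ B) (hc : c ∈ C) (d : A) : lam (lam c b) d = lam b d := by
  have hcb : lam c b ∈ B := h.left_isLeftIdeal c b hb
  have hc' : lam (lam c b)⁻¹ c ∈ C := h.right_isLeftIdeal _ c hc
  have lam_eq_on_right : ∀ d ∈ C, lam (lam c b) d = lam b d := fun d hd =>
    calc lam (lam c b) d
        = lam (lam c b) (lam (lam (lam c b)⁻¹ c) d) := by rw [hC.lam_eq hc' hd]
      _ = lam c (lam b d) := by rw [← lam_mul, ← mul_eq_lam_mul, lam_mul]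
      _ = lam b d := hC.lam_eq hc (h.right_isLeftIdeal b d hd)
  obtain ⟨d₁, hd₁, d₂, hd₂, rfl⟩ := h.exists_add d
  rw [lam_add, lam_add, hB.lam_eq hb hd₁, hB.lam_eq hcb hd₁, lam_eq_on_right d₂ hd₂]

theorem mk_socle_lam_of_mem_right (h : IsFactorization B C) (hB : IsTrivialOn B)
    (hC : IsTrivialOn C) {c : A} (hc : c ∈ C) (d : A) :
    QuotientBrace.mk socle_isIdeal (lam c d) = QuotientBrace.mk socle_isIdeal d := by
  obtain ⟨d₁, hd₁, d₂, hd₂, rfl⟩ := h.exists_add d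
  rw [lam_add, hC.lam_eq hc hd₂, QuotientBrace.mk_add, QuotientBrace.mk_add,
    QuotientBrace.mk_socle_eq.2 (h.lam_lam_eq hB hC hd₁ hc)]

theorem isTrivialOn_quotient_socle (h : IsFactorization B C) (hB : IsTrivialOn B)
    (hC : IsTrivialOn C) :
    IsTrivialOn (⊤ : AddSubgroup (QuotientBrace (socle A) socle_isIdeal)) := by
  refine QuotientBrace.isTrivialOn_top _ fun a d => ?_
  obtain ⟨b, hb, c, hc, rfl⟩ := h.exists_mul a
  rw [lam_mul, h.symm.mk_socle_lam_of_mem_right hC hB hb, h.mk_socle_lam_of_mem_right hB hC hc]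

end IsFactorization

end LeftBrace

namespace YB.Solution

open LeftBrace

variable {X : Type u} (S : Solution X) {A : Type*} [LeftBrace A]

/-- An embedding of the solution `(X, r)` into the left brace `A` whose image generates `(A, +)`.
Compatibility is only asked of `λ` and `σ`, since an involutive solution is determined by `σ`. The
notion is stable under retraction of `X` and division of `A` by its socle, see `ret`. -/
structure IsGeneratingEmbedding (f : X → A) : Prop where
  injective : Function.Injective f
  lam_map : ∀ x y, lam (f x) (f y) = f (S.sig x y)
  closure_range : AddSubgroup.closure (Set.range f) = ⊤

theorem closure_range_of : AddSubgroup.closure (Set.range S.of) = ⊤ := by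
  let e : S.StructureGroup ≃+ FreeAbelianGroup X := AddEquiv.mk' S.cocycleEquiv S.cocycle_add
  have symm_of : ∀ x, e.symm (FreeAbelianGroup.of x) = S.of x := fun x =>
    e.symm_apply_eq.2 (S.cocycle_of x).symm
  have of_mem : ∀ x, S.of x ∈ AddSubgroup.closure (Set.range S.of) := fun x =>
    AddSubgroup.subset_closure (Set.mem_range_self x)
  refine (AddSubgroup.eq_top_iff' _).2 fun g => ?_
  obtain ⟨m, rfl⟩ := e.symm.surjective g
  induction m using FreeAbelianGroup.induction_on with
  | zero => exact map_zero e.symm ▸ zero_mem _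
  | of x => exact symm_of x ▸ of_mem x
  | neg x _ => rw [map_neg, symm_of]; exact neg_mem (of_mem x)
  | add a b ha hb => exact map_add e.symm a b ▸ add_mem ha hb

theorem isGeneratingEmbedding_of : S.IsGeneratingEmbedding S.of where
  injective x y h := FreeAbelianGroup.of_injective <| by
    rw [← S.cocycle_of, ← S.cocycle_of, h]
  lam_map x y := by rw [lam, of_mul_of_eq_add, neg_add_cancel_left]
  closure_range := S.closure_range_of

namespace IsGeneratingEmbedding

variable {S} {f : X → A}

theorem mk_socle_eq_iff_sig_eq (hf : S.IsGeneratingEmbedding f) {x y : X} :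
    QuotientBrace.mk socle_isIdeal (f x) = QuotientBrace.mk socle_isIdeal (f y) ↔
      S.sig x = S.sig y := by
  rw [QuotientBrace.mk_socle_eq]
  constructor
  · intro h
    ext z
    apply hf.injective
    rw [← hf.lam_map, ← hf.lam_map, h]
  · intro h
    refine lam_eq_of_closure_eq_top hf.closure_range ?_
    rintro _ ⟨z, rfl⟩
    rw [hf.lam_map, hf.lam_map, h]

/-- The map `Ret(X, r) → A / Soc(A)` induced by an embedding `X → A`. -/
noncomputable def retMap (hf : S.IsGeneratingEmbedding f) :
    S.RetType → QuotientBrace (socle A) socle_isIdeal :=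
  Quotient.lift (fun x => QuotientBrace.mk socle_isIdeal (f x)) fun _ _ h =>
    hf.mk_socle_eq_iff_sig_eq.2 h

theorem retMap_toRet (hf : S.IsGeneratingEmbedding f) (x : X) :
    hf.retMap (S.toRet x) = QuotientBrace.mk socle_isIdeal (f x) := rfl

theorem range_retMap (hf : S.IsGeneratingEmbedding f) :
    Set.range hf.retMap = QuotientBrace.mk socle_isIdeal '' Set.range f := by
  rw [← S.toRet_surjective.range_comp, ← Set.range_comp]
  rfl

theorem ret (hf : S.IsGeneratingEmbedding f) : S.ret.IsGeneratingEmbedding hf.retMap where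
  injective := by
    refine S.toRet_surjective.forall₂.2 fun x y h => S.toRet_eq.2 ?_
    exact hf.mk_socle_eq_iff_sig_eq.1 h
  lam_map := by
    refine S.toRet_surjective.forall₂.2 fun x y => ?_
    calc lam (hf.retMap (S.toRet x)) (hf.retMap (S.toRet y))
        = QuotientBrace.mk socle_isIdeal (lam (f x) (f y)) := by
          rw [retMap_toRet, retMap_toRet, QuotientBrace.mk_lam]
      _ = hf.retMap (S.toRet (S.sig x y)) := by rw [hf.lam_map, retMap_toRet]
  closure_range := by
    rw [hf.range_retMap]
    exact QuotientBrace.closure_image_mk_eq_top _ hf.closure_range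

theorem subsingleton_retType (hf : S.IsGeneratingEmbedding f)
    (hA : IsTrivialOn (⊤ : AddSubgroup A)) : Subsingleton S.RetType := by
  have sig_eq_one : ∀ x, S.sig x = 1 := fun x => Equiv.ext fun y => hf.injective <| by
    rw [← hf.lam_map, hA.lam_eq (AddSubgroup.mem_top _) (AddSubgroup.mem_top _),
      Equiv.Perm.one_apply]
  refine ⟨S.toRet_surjective.forall₂.2 fun x y => S.toRet_eq.2 ?_⟩
  rw [sig_eq_one, sig_eq_one]

end IsGeneratingEmbedding

theorem nonempty_iterRet [Nonempty X] (n : ℕ) : Nonempty (S.iterRet n).1 := by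
  induction n with
  | zero => assumption
  | succ n ih => exact ih.map (S.iterRet n).2.toRet

theorem card_iterRet_eq_one_iff [Nonempty X] {n : ℕ} :
    Nat.card (S.iterRet n).1 = 1 ↔ Subsingleton (S.iterRet n).1 := by
  rw [Nat.card_eq_one_iff_unique, and_iff_left (S.nonempty_iterRet n)]

theorem exists_isMultipermutation_le [Nonempty X] {n : ℕ} (h : Subsingleton (S.iterRet n).1) :
    ∃ m ≤ n, S.IsMultipermutation m := by
  classical
  have hex : ∃ m, Subsingleton (S.iterRet m).1 := ⟨n, h⟩
  refine ⟨Nat.find hex, Nat.find_min' hex h, S.card_iterRet_eq_one_iff.2 (Nat.find_spec hex), ?_⟩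
  intro k hk
  exact not_subsingleton_iff_nontrivial.1 (Nat.find_min hex (by omega))

end YB.Solution

theorem corollary2p13 {X : Type u} [Nontrivial X] (S : YB.Solution X)
    (h : ∃ B C : AddSubgroup S.PermutationBrace,
      LeftBrace.IsFactorization B C ∧ LeftBrace.IsTrivialOn B ∧ LeftBrace.IsTrivialOn C) :
    ∃ m ≤ 3, S.IsMultipermutation m := by
  obtain ⟨B, C, hBC, hB, hC⟩ := h
  have ret_ret_embeds := S.isGeneratingEmbedding_of.ret.ret
  have subsingleton_ret_three : Subsingleton (S.iterRet 3).1 :=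
    ret_ret_embeds.subsingleton_retType (hBC.isTrivialOn_quotient_socle hB hC)
  exact S.exists_isMultipermutation_le subsingleton_ret_three
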